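/- Let $d,m,k$ be integers with $d\ge 1$, $m\ge 2$, $k\ge 1$, and put $n=m^d$. Let $f:[0,1]^d\to\mathbb R$ satisfy $|f(x)-f(y)|\le M\|x-y\|_2^{\alpha}$ for all $x,y\in[0,1]^d$, where $M>0$ and $\alpha\in(0,1]$. Let $V=\{1,\dots,m\}^d$ and, for $\mathbf i\in V$, let $x_{\mathbf i}=\big(\tfrac{i_1-1}{m-1},\dots,\tfrac{i_d-1}{m-1}\big)\in[0,1]^d$. Let $\eta_{\mathbf i}\in\mathbb R$ $(\mathbf i\in V)$ be arbitrary noise values, $y_{\mathbf i}=(f(x_{\mathbf i})+\eta_{\mathbf i})\bmod 1$, $h_{\mathbf i}=\exp(2\pi\iota f(x_{\mathbf i}))$ and $z_{\mathbf i}=\exp(2\pi\iota y_{\mathbf i})$. Write $\bar h=(\mathrm{Re}\,h,\mathrm{Im}\,h)\in\mathbb R^{2n}$ and $\bar z=(\mathrm{Re}\,z,\mathrm{Im}\,z)\in\mathbb R^{2n}$, and assume $\|\bar z-\bar h\|_2\le\delta\sqrt n$ for some $\delta\in[0,1]$. Let $G$ be the graph on $V$ in which distinct $\mathbf i,\mathbf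 j$ are adjacent if and only if $\|\mathbf i-\mathbf j\|_\infty\le k$; let $L$ be its Laplacian matrix, $\lambda\ge 0$, $H=\begin{pmatrix}\lambda L&0\\0&\lambda L\end{pmatrix}$, and let $\mathcal N(H)$ be the null space of $H$. Let $\kappa_{k,d}$ be the vertex connectivity of $G$ (the least number of vertices whose removal leaves a disconnected graph or a single vertex). Consider the trust-region problem $$\min_{\bar g\in\mathbb R^{2n},\ \|\bar g\|_2^2=n}\ \bar g^{T}H\bar g-2\bar g^{T}\bar z .\qquad (\ast)$$ 1. If $\bar z\not\perp\mathcal N(H)$, then $(\ast)$ has a unique solution $\hat g$, and $$\frac1n\langle\bar h,\hat g\rangle\ \ge\ 1-\frac{3\delta}2-\frac{\lambda\pi^2M^2(2k)^{2\alpha}d^{2\alpha}[(2k+1)^d-1]}{n^{2\alpha/d}}+\frac1{(2\lambda[(2k+1)^d-1]+1)^2}\Big(\frac1{2n}\bar z^{T}H\bar z\Big).$$ 2. If $\bar z\perp\mathcal N(H)$ and $\lambda<\frac1{2((2k+1)^d-1)}$, then $(\ast)$ has a unique solution $\hat g$, and $$\frac1n\langle\bar h,\hat g\rangle\ \ge\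 1-\frac{3\delta}2-\frac{\lambda\pi^2M^2(2k)^{2\alpha}d^{2\alpha}[(2k+1)^d-1]}{n^{2\alpha/d}}+\frac1{\big(1+2\lambda[(2k+1)^d-1]-4\lambda\kappa_{k,d}\sin^2\left(\frac{\pi}{2n}\right)\big)^2}\Big(\frac1{2n}\bar z^{T}H\bar z\Big).$$ Moreover, $\kappa_{k,d}\le(k+1)^d-1$. -/

import Mathlib

noncomputable section

/-- Index set `{1, …, m}^d` of the regular grid; the coordinates are shifted to `0, …, m - 1`. -/
abbrev GridIndex (d m : ℕ) : Type := Fin d → Fin m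

/-- The grid point with coordinates `i_a / (m - 1)`. -/
def gridPoint {d m : ℕ} (i : GridIndex d m) : EuclideanSpace ℝ (Fin d) :=
  WithLp.toLp 2 fun a => ((i a : ℕ) : ℝ) / ((m : ℝ) - 1)

/-- `f` is Hölder continuous on the cube `[0,1]^d` with constant `M` and exponent `α`,
with respect to the Euclidean norm. -/
def HolderOnCube {d : ℕ} (f : EuclideanSpace ℝ (Fin d) → ℝ) (M α : ℝ) : Prop :=
  ∀ x y : EuclideanSpace ℝ (Fin d),
    (∀ a, x a ∈ Set.Icc (0 : ℝ) 1) → (∀ a, y a ∈ Set.Icc (0 : ℝ) 1) →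
      |f x - f y| ≤ M * ‖x - y‖ ^ α

/-- The regularization graph: two distinct indices are adjacent when their Chebyshev distance
is at most `k`. -/
def chebyshevGraph (d m k : ℕ) : SimpleGraph (GridIndex d m) where
  Adj i j := i ≠ j ∧ ∀ a, |((i a : ℕ) : ℤ) - ((j a : ℕ) : ℤ)| ≤ (k : ℤ)
  symm := ⟨fun i j h => ⟨h.1.symm, fun a => by rw [abs_sub_comm]; exact h.2 a⟩⟩
  loopless := ⟨fun _ h => h.1 rfl⟩

instance (d m k : ℕ) : DecidableRel (chebyshevGraph d m k).Adj :=
  fun i j => inferInstanceAs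
    (Decidable (i ≠ j ∧ ∀ a, |((i a : ℕ) : ℤ) - ((j a : ℕ) : ℤ)| ≤ (k : ℤ)))

/-- Vertex connectivity of a finite graph: the least number of vertices whose removal leaves a
disconnected graph or at most one vertex (so that it is `n - 1` for the complete graph on
`n` vertices). -/
def vertexConnectivity {V : Type*} [Fintype V] (G : SimpleGraph V) : ℕ :=
  sInf {c : ℕ | ∃ S : Finset V, S.card = c ∧
    (¬ (G.induce ((S : Set V)ᶜ)).Connected ∨ Fintype.card V ≤ S.card + 1)}

/-- The representation `exp(2πι t)` on the unit circle, entrywise. -/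
def angular {V : Type*} (t : V → ℝ) : V → ℂ :=
  fun i => Complex.exp (2 * (Real.pi : ℂ) * Complex.I * (t i : ℂ))

/-- The real version `(Re g, Im g) ∈ ℝ^{2n}` of a complex vector `g ∈ ℂ^n`. -/
def realVec {V : Type*} (g : V → ℂ) : EuclideanSpace ℝ (V ⊕ V) :=
  WithLp.toLp 2 (Sum.elim (fun i => (g i).re) (fun i => (g i).im))

/-- The matrix `H = diag(λL, λL)`, with `L` the Laplacian of the regularization graph. -/
def blockLaplacian (d m k : ℕ) (lam : ℝ) :
    Matrix (GridIndex d m ⊕ GridIndex d m) (GridIndex d m ⊕ GridIndex d m) ℝ :=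
  Matrix.fromBlocks (lam • (chebyshevGraph d m k).lapMatrix ℝ) 0 0
    (lam • (chebyshevGraph d m k).lapMatrix ℝ)

/-- The quadratic form `gᵀ A g`. -/
def quadForm {ι : Type*} [Fintype ι] (A : Matrix ι ι ℝ) (g : EuclideanSpace ℝ ι) : ℝ :=
  dotProduct g.ofLp (A.mulVec g.ofLp)

/-- The null space of `A`, as a subspace of Euclidean space. -/
def nullSpace {ι : Type*} [Fintype ι] [DecidableEq ι] (A : Matrix ι ι ℝ) :
    Submodule ℝ (EuclideanSpace ℝ ι) :=
  LinearMap.ker (Matrix.toEuclideanLin A)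

/-- `g` solves the trust-region problem `min gᵀ A g - 2 gᵀ z` over the sphere `‖g‖² = n`. -/
def IsTRSSolution {ι : Type*} [Fintype ι] (A : Matrix ι ι ℝ) (z : EuclideanSpace ℝ ι) (n : ℝ)
    (g : EuclideanSpace ℝ ι) : Prop :=
  ‖g‖ ^ 2 = n ∧
    ∀ g' : EuclideanSpace ℝ ι, ‖g'‖ ^ 2 = n →
      quadForm A g - 2 * inner ℝ g z ≤ quadForm A g' - 2 * inner ℝ g' z

end

/-! Everything rests on the stationarity equation `(H + μ) g = z` with `μ > 0` and `‖g‖ = ‖z‖ = √n`.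
For any `g'` on the sphere, the objective at `g'` exceeds that at `g` by `⟨g' - g, (H + μ)(g' - g)⟩`
(`trust_region_identity`). Hence `g` is the unique solution, and `g' = h` gives the estimate.

Such a `μ` comes from the intermediate value theorem for `‖(H + μ)⁻¹ z‖` on `[μ₀, 1]`. This norm is
at most `‖z‖` at `1`, and `μ₀` is chosen so that it is at least `‖z‖` there.

In the estimate, `hᵀHh` is small by Hölder continuity, and `gᵀHg ≥ zᵀHz / (Λ + μ)²` with `Λ =
2λ((2k+1)^d - 1)`. Only an upper bound for `μ` remains: `1` in general. When `z` is orthogonal to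
the null space, so is `g`, and Fiedler's spectral gap bound sharpens it. That bound follows by
sorting the entries and combining the discrete Wirtinger inequality with the fact that every edge
cut has at least `κ` edges. -/

namespace LinearMap

/-! ### Positive operators and their positive shifts. -/

variable {E : Type*} [NormedAddCommGroup E] [InnerProductSpace ℝ E] {T : E →ₗ[ℝ] E}

/-- A positive operator bounded above by `Λ` as a form satisfies `T² ≤ Λ T`. -/
theorem IsPositive.norm_sq_apply_le (hT : T.IsPositive) {Λ : ℝ} (hΛ₀ : 0 ≤ Λ)
    (hΛ : ∀ x, inner ℝ x (T x) ≤ Λ * ‖x‖ ^ 2) (x : E) :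
    ‖T x‖ ^ 2 ≤ Λ * inner ℝ x (T x) := by
  -- Positivity at `x - t • T x`, with `⟨T x, T (T x)⟩` bounded by `Λ‖T x‖²`. The optimal choice is
  -- `t = Λ⁻¹`.
  have key : ∀ t : ℝ, 0 ≤ inner ℝ x (T x) - 2 * t * ‖T x‖ ^ 2 + t ^ 2 * (Λ * ‖T x‖ ^ 2) := by
    intro t
    have h0 : 0 ≤ inner ℝ (T (x - t • T x)) (x - t • T x) := hT.re_inner_nonneg_left _
    have h1 := hT.isSymmetric x (T x)
    have h2 := hΛ (T x)
    rw [real_inner_comm] at h0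
    simp only [map_sub, map_smul, inner_sub_left, inner_sub_right, inner_smul_left,
      inner_smul_right, RCLike.conj_to_real, ← h1, real_inner_self_eq_norm_sq] at h0
    nlinarith [mul_le_mul_of_nonneg_left h2 (sq_nonneg t)]
  rcases hΛ₀.eq_or_lt with h | h
  · subst h
    have := key 1
    have := hΛ x
    nlinarith
  · have := key Λ⁻¹
    have h3 : inner ℝ x (T x) - 2 * Λ⁻¹ * ‖T x‖ ^ 2 + Λ⁻¹ ^ 2 * (Λ * ‖T x‖ ^ 2)
        = inner ℝ x (T x) - ‖T x‖ ^ 2 / Λ := by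
      field_simp
      ring
    rw [h3, sub_nonneg, div_le_iff₀ h] at this
    linarith

/-- Cauchy–Schwarz against `g`. It bounds the inverse of `T + μ` by `1/μ`, which yields solvability,
continuity in `μ` and the endpoint `μ = 1`. -/
theorem IsPositive.norm_shift_le (hT : T.IsPositive) {μ : ℝ} (g : E) :
    μ * ‖g‖ ≤ ‖T g + μ • g‖ := by
  rcases eq_or_ne g 0 with rfl | hg
  · simp
  have h0 : 0 ≤ inner ℝ (T g) g := hT.re_inner_nonneg_left _
  have h1 : inner ℝ (T g + μ • g) g ≤ ‖T g + μ • g‖ * ‖g‖ := real_inner_le_norm _ _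
  rw [inner_add_left, inner_smul_left, RCLike.conj_to_real, real_inner_self_eq_norm_sq] at h1
  have : 0 < ‖g‖ := norm_pos_iff.2 hg
  nlinarith

theorem IsPositive.exists_shift_eq [FiniteDimensional ℝ E] (hT : T.IsPositive) {μ : ℝ}
    (hμ : 0 < μ) (z : E) : ∃ g, T g + μ • g = z := by
  have hinj : Function.Injective (T + μ • (LinearMap.id : E →ₗ[ℝ] E)) := by
    rw [← LinearMap.ker_eq_bot, LinearMap.ker_eq_bot']
    intro g hg
    have h1 := hT.norm_shift_le (μ := μ) g
    have h2 : T g + μ • g = 0 := by simpa using hg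
    rw [h2, norm_zero] at h1
    have : ‖g‖ ≤ 0 := by
      by_contra! h
      nlinarith [mul_pos hμ h]
    simpa using this
  obtain ⟨g, hg⟩ := LinearMap.injective_iff_surjective.1 hinj z
  exact ⟨g, by simpa using hg⟩

/-- If some shift `μ₀ ∈ (0, 1]` gives a solution of norm at least `‖z‖`, then some shift in
`[μ₀, 1]` gives a solution of norm exactly `‖z‖`. -/
theorem IsPositive.exists_shift_norm_eq [FiniteDimensional ℝ E] (hT : T.IsPositive)
    {μ₀ : ℝ} (hμ₀ : 0 < μ₀) (hμ₁ : μ₀ ≤ 1) {g₀ z : E} (hg₀ : T g₀ + μ₀ • g₀ = z)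
    (hz : ‖z‖ ≤ ‖g₀‖) :
    ∃ μ g, μ₀ ≤ μ ∧ μ ≤ 1 ∧ T g + μ • g = z ∧ ‖g‖ = ‖z‖ := by
  have hex : ∀ μ : ℝ, ∃ g, 0 < μ → T g + μ • g = z := fun μ => by
    by_cases hμ : 0 < μ
    · obtain ⟨g, hg⟩ := hT.exists_shift_eq hμ z
      exact ⟨g, fun _ => hg⟩
    · exact ⟨0, fun h => absurd h hμ⟩
  choose G hG using hex
  have hlip : ∀ μ ∈ Set.Icc μ₀ 1, ∀ ν ∈ Set.Icc μ₀ 1,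
      dist (G μ) (G ν) ≤ ‖z‖ / μ₀ ^ 2 * dist μ ν := by
    intro μ hμ ν hν
    have hμp : 0 < μ := hμ₀.trans_le hμ.1
    have hνp : 0 < ν := hμ₀.trans_le hν.1
    -- Resolvent identity; one factor `1/μ₀` comes from this equation and another from bounding `G
    -- ν`.
    have e : T (G μ - G ν) + μ • (G μ - G ν) = (ν - μ) • G ν := by
      have e1 := hG μ hμp
      have e2 := hG ν hνp
      have : T (G μ - G ν) + μ • (G μ - G ν)
          = (T (G μ) + μ • G μ) - (T (G ν) + ν • G ν) + (ν - μ) • G ν := by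
        rw [map_sub]
        module
      rw [this, e1, e2, sub_self, zero_add]
    have h1 := hT.norm_shift_le (μ := μ) (G μ - G ν)
    rw [e, norm_smul] at h1
    have h2 := hT.norm_shift_le (μ := ν) (G ν)
    rw [hG ν hνp] at h2
    rw [dist_eq_norm, dist_comm μ ν, Real.dist_eq]
    rw [Real.norm_eq_abs] at h1
    have h3 : μ₀ * ‖G ν‖ ≤ ‖z‖ :=
      (mul_le_mul_of_nonneg_right hν.1 (norm_nonneg _)).trans h2
    have h4 : μ₀ * ‖G μ - G ν‖ ≤ |ν - μ| * ‖G ν‖ :=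
      (mul_le_mul_of_nonneg_right hμ.1 (norm_nonneg _)).trans h1
    rw [div_mul_eq_mul_div, le_div_iff₀ (by positivity)]
    nlinarith [mul_le_mul_of_nonneg_left h3 (abs_nonneg (ν - μ)),
      mul_le_mul_of_nonneg_left h4 hμ₀.le]
  have hcont : ContinuousOn (fun μ => ‖G μ‖) (Set.Icc μ₀ 1) := by
    refine ContinuousOn.norm ?_
    exact (LipschitzOnWith.of_dist_le_mul (K := ⟨‖z‖ / μ₀ ^ 2, by positivity⟩)
      (fun x hx y hy => hlip x hx y hy)).continuousOn
  have hstart : ‖z‖ ≤ ‖G μ₀‖ := by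
    have h1 := hT.norm_shift_le (μ := μ₀) (G μ₀ - g₀)
    have : T (G μ₀ - g₀) + μ₀ • (G μ₀ - g₀) = 0 := by
      rw [map_sub, smul_sub, sub_add_sub_comm, hG μ₀ hμ₀, hg₀, sub_self]
    rw [this, norm_zero] at h1
    have h2 : ‖G μ₀ - g₀‖ = 0 := by
      refine le_antisymm ?_ (norm_nonneg _)
      by_contra! h
      nlinarith [mul_pos hμ₀ h]
    rwa [sub_eq_zero.1 (norm_eq_zero.1 h2)]
  have hend : ‖G 1‖ ≤ ‖z‖ := by
    have h1 := hT.norm_shift_le (μ := 1) (G 1)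
    rwa [hG 1 one_pos, one_mul] at h1
  obtain ⟨μ, hμ, hμz⟩ := intermediate_value_Icc' hμ₁ hcont ⟨hend, hstart⟩
  exact ⟨μ, G μ, hμ.1, hμ.2, hG μ (hμ₀.trans_le hμ.1), hμz⟩

/-- On a sphere, adding `μ‖·‖²` changes the objective by a constant only, and `g` is the critical
point of the resulting quadratic, so no linear term survives. -/
theorem IsPositive.trust_region_identity (hT : T.IsPositive) {μ : ℝ} {g g' z : E}
    (hg : T g + μ • g = z) (hn : ‖g'‖ ^ 2 = ‖g‖ ^ 2) :
    inner ℝ g' (T g') - 2 * inner ℝ g' z = inner ℝ g (T g) - 2 * inner ℝ g z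
      + inner ℝ (g' - g) (T (g' - g)) + μ * ‖g' - g‖ ^ 2 := by
  subst hg
  have h1 := hT.isSymmetric g g'
  rw [real_inner_comm] at h1
  rw [← real_inner_self_eq_norm_sq, ← real_inner_self_eq_norm_sq] at hn
  rw [← real_inner_self_eq_norm_sq]
  simp only [map_sub, inner_sub_left, inner_sub_right, inner_add_right, inner_smul_right]
  rw [real_inner_comm g' g]
  linear_combination (-μ) * hn - h1

/-- In spectral terms, `T (T + μ)² ≤ (Λ + μ)² T`. This passes from the energy of the data `z` to
that of the solution. -/
theorem IsPositive.inner_shift_le (hT : T.IsPositive) {Λ : ℝ} (hΛ₀ : 0 ≤ Λ)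
    (hΛ : ∀ x, inner ℝ x (T x) ≤ Λ * ‖x‖ ^ 2) {μ : ℝ} (hμ : 0 ≤ μ) (g : E) :
    inner ℝ (T g + μ • g) (T (T g + μ • g)) ≤ (Λ + μ) ^ 2 * inner ℝ g (T g) := by
  have h1 := hT.norm_sq_apply_le hΛ₀ hΛ g
  have h2 := hΛ (T g)
  have h3 := hT.isSymmetric g (T g)
  simp only [map_add, map_smul, inner_add_left, inner_add_right, inner_smul_left,
    inner_smul_right, RCLike.conj_to_real, ← h3, real_inner_self_eq_norm_sq]
  nlinarith [mul_le_mul_of_nonneg_left h1 hΛ₀, mul_le_mul_of_nonneg_left h1 hμ]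

theorem IsPositive.norm_shift_le_add (hT : T.IsPositive) {Λ : ℝ} (hΛ₀ : 0 ≤ Λ)
    (hΛ : ∀ x, inner ℝ x (T x) ≤ Λ * ‖x‖ ^ 2) {μ : ℝ} (hμ : 0 ≤ μ) (g : E) :
    ‖T g + μ • g‖ ≤ (Λ + μ) * ‖g‖ := by
  have h1 : ‖T g‖ ≤ Λ * ‖g‖ := by
    refine abs_le_of_sq_le_sq' ?_ (by positivity) |>.2
    have := hT.norm_sq_apply_le hΛ₀ hΛ g
    nlinarith [mul_le_mul_of_nonneg_left (hΛ g) hΛ₀]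
  calc ‖T g + μ • g‖ ≤ ‖T g‖ + ‖μ • g‖ := norm_add_le _ _
    _ ≤ _ := by rw [norm_smul, Real.norm_of_nonneg hμ]; linarith

end LinearMap

/-! ### Discrete Dirichlet and Wirtinger inequalities. -/

section

open Finset

/-- The discrete Dirichlet (Fan–Taussky–Todd) inequality. -/
theorem sum_mul_succ_le_cos_mul_sum_sq {n : ℕ} (hn : 1 ≤ n) (s : ℕ → ℝ) (h0 : s 0 = 0)
    (hsn : s n = 0) :
    ∑ i ∈ range n, 2 * (s i * s (i + 1)) ≤
      ∑ i ∈ range n, 2 * Real.cos (Real.pi / n) * s i ^ 2 := by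
  -- The Dirichlet ground state: zero at `0` and `n`, positive between, with eigenvalue `2 cos(π/n)`
  -- for the sum of the two neighbours.
  set w : ℕ → ℝ := fun i => Real.sin (i * (Real.pi / n)) with hw
  have hn0 : (0 : ℝ) < n := by exact_mod_cast hn
  have hrec : ∀ j, w (j + 2) + w j = 2 * Real.cos (Real.pi / n) * w (j + 1) := by
    intro j
    simp only [hw]
    have e1 : ((j + 2 : ℕ) : ℝ) * (Real.pi / n)
        = ((j + 1 : ℕ) : ℝ) * (Real.pi / n) + Real.pi / n := by push_cast; ring
    have e2 : (j : ℝ) * (Real.pi / n)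
        = ((j + 1 : ℕ) : ℝ) * (Real.pi / n) - Real.pi / n := by push_cast; ring
    rw [e1, e2, Real.sin_add, Real.sin_sub]
    ring
  have hw0 : w 0 = 0 := by simp [hw]
  have hwn : w n = 0 := by
    simp only [hw]
    rw [mul_div_cancel₀ _ hn0.ne', Real.sin_pi]
  have hpos : ∀ j, 1 ≤ j → j < n → 0 < w j := by
    intro j hj hjn
    have hj' : (0 : ℝ) < j := by exact_mod_cast hj
    have hjn' : (j : ℝ) < n := by exact_mod_cast hjn
    refine Real.sin_pos_of_pos_of_lt_pi (by positivity) ?_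
    rw [mul_div_assoc', div_lt_iff₀ hn0, mul_comm]
    exact mul_lt_mul_of_pos_left hjn' Real.pi_pos
  -- Weighted AM–GM at each step leaves a boundary remainder that the next step absorbs. At the end,
  -- `w n = 0` makes the remainder equal to the last diagonal term.
  have main : ∀ j, j + 1 < n → ∑ i ∈ range (j + 1), 2 * (s i * s (i + 1)) ≤
      ∑ i ∈ range (j + 1), 2 * Real.cos (Real.pi / n) * s i ^ 2
        + s (j + 1) ^ 2 * (w j / w (j + 1)) := by
    intro j
    induction j with
    | zero => intro _; simp [h0, hw0]
    | succ j ih =>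
      intro hj
      have ih' := ih (by omega)
      have p1 := hpos (j + 1) (by omega) (by omega)
      have p2 := hpos (j + 2) (by omega) (by omega)
      rw [sum_range_succ _ (j + 1), sum_range_succ _ (j + 1)]
      have hc : 2 * Real.cos (Real.pi / n) = w (j + 2) / w (j + 1) + w j / w (j + 1) := by
        rw [← add_div, hrec, mul_div_cancel_right₀ _ p1.ne']
      have hsq : 2 * (s (j + 1) * s (j + 2)) ≤
          s (j + 1) ^ 2 * (w (j + 2) / w (j + 1)) + s (j + 2) ^ 2 * (w (j + 1) / w (j + 2)) := by
        have : s (j + 1) ^ 2 * (w (j + 2) / w (j + 1)) + s (j + 2) ^ 2 * (w (j + 1) / w (j + 2))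
            - 2 * (s (j + 1) * s (j + 2))
            = (s (j + 1) * w (j + 2) - s (j + 2) * w (j + 1)) ^ 2 / (w (j + 1) * w (j + 2)) := by
          field_simp
          ring
        have h2 : 0 ≤ (s (j + 1) * w (j + 2) - s (j + 2) * w (j + 1)) ^ 2
            / (w (j + 1) * w (j + 2)) := by positivity
        linarith
      have hc' : 2 * Real.cos (Real.pi / n) * s (j + 1) ^ 2
          = s (j + 1) ^ 2 * (w (j + 2) / w (j + 1)) + s (j + 1) ^ 2 * (w j / w (j + 1)) := by
        rw [hc]; ring
      rw [hc']
      linarith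
  obtain rfl | ⟨j, rfl⟩ : n = 1 ∨ ∃ j, n = j + 2 := by
    rcases n with _ | _ | j
    · omega
    · exact Or.inl rfl
    · exact Or.inr ⟨j, rfl⟩
  · simp [h0]
  · have p1 := hpos (j + 1) (by omega) (by omega)
    have hm := main j (by omega)
    rw [sum_range_succ _ (j + 1), sum_range_succ _ (j + 1), hsn]
    have hc : 2 * Real.cos (Real.pi / (j + 2 : ℕ)) = w j / w (j + 1) := by
      rw [eq_div_iff p1.ne', ← hrec, hwn, zero_add]
    have : 2 * Real.cos (Real.pi / (j + 2 : ℕ)) * s (j + 1) ^ 2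
        = s (j + 1) ^ 2 * (w j / w (j + 1)) := by rw [hc]; ring
    rw [this]
    linarith

/-- The discrete Wirtinger inequality: the spectral gap of the path on `n` vertices is
`4 sin²(π / 2n)`. -/
theorem sin_sq_mul_sum_sq_le_sum_diff_sq {n : ℕ} (hn : 1 ≤ n) (x : ℕ → ℝ)
    (hx : ∑ i ∈ range n, x i = 0) :
    4 * Real.sin (Real.pi / (2 * n)) ^ 2 * ∑ i ∈ range n, x i ^ 2
      ≤ ∑ i ∈ range (n - 1), (x (i + 1) - x i) ^ 2 := by
  -- The partial sums vanish at both ends because the total is zero, so the Dirichlet inequality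
  -- applies to them.
  set s : ℕ → ℝ := fun j => ∑ i ∈ range j, x i with hs
  have hs1 : ∀ j, s (j + 1) = s j + x j := fun j => sum_range_succ _ _
  have hs0 : s 0 = 0 := by simp [hs]
  have hD := sum_mul_succ_le_cos_mul_sum_sq hn s hs0 hx
  obtain ⟨k, rfl⟩ : ∃ k, n = k + 1 := ⟨n - 1, by omega⟩
  have hsn : s (k + 1) = 0 := hx
  rw [Nat.add_sub_cancel]
  have abel : ∀ j, ∑ i ∈ range (j + 1), x i ^ 2
      = x j * s (j + 1) - ∑ i ∈ range j, s (i + 1) * (x (i + 1) - x i) := by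
    intro j
    induction j with
    | zero => simp [hs]; ring
    | succ j ih =>
      rw [sum_range_succ, ih, sum_range_succ _ j, hs1 (j + 1)]
      ring
  have hX := abel k
  rw [hsn, mul_zero, zero_sub] at hX
  have hS : ∑ i ∈ range (k + 1), s i ^ 2 = ∑ i ∈ range k, s (i + 1) ^ 2 := by
    rw [sum_range_succ', hs0]; simp
  have hS' : ∑ i ∈ range (k + 1), s (i + 1) ^ 2 = ∑ i ∈ range k, s (i + 1) ^ 2 := by
    rw [sum_range_succ, hsn]; simp
  -- Summation by parts and Cauchy–Schwarz give `X² ≤ S Q`. The Dirichlet inequality gives `L S ≤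
  -- X`; together `L X² ≤ X Q`, and one divides by `X`.
  have hCS := sum_mul_sq_le_sq_mul_sq (range k) (fun i => s (i + 1)) (fun i => x (i + 1) - x i)
  have hXd : ∑ i ∈ range (k + 1), x i ^ 2 = ∑ i ∈ range (k + 1), s (i + 1) ^ 2
      + ∑ i ∈ range (k + 1), s i ^ 2 - ∑ i ∈ range (k + 1), 2 * (s i * s (i + 1)) := by
    rw [← sum_add_distrib, ← sum_sub_distrib]
    refine sum_congr rfl fun i _ => ?_
    rw [hs1]
    ring
  rw [← mul_sum _ (fun i => s i ^ 2) _] at hD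
  have hcos : 2 - 2 * Real.cos (Real.pi / (k + 1 : ℕ))
      = 4 * Real.sin (Real.pi / (2 * (k + 1 : ℕ))) ^ 2 := by
    have : Real.pi / (k + 1 : ℕ) = 2 * (Real.pi / (2 * (k + 1 : ℕ))) := by
      field_simp
    rw [this, Real.cos_two_mul, Real.sin_sq]
    ring
  rw [hS', ← hS] at hXd
  rw [← hS] at hCS
  rw [← hcos]
  rw [← neg_sq, ← hX] at hCS
  generalize ∑ i ∈ range (k + 1), x i ^ 2 = X at *
  have hX0 : (0 : ℝ) ≤ ∑ i ∈ range k, (x (i + 1) - x i) ^ 2 :=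
    sum_nonneg fun i _ => sq_nonneg _
  generalize ∑ i ∈ range k, (x (i + 1) - x i) ^ 2 = Q at *
  generalize ∑ i ∈ range (k + 1), s i ^ 2 = S at *
  generalize ∑ i ∈ range (k + 1), 2 * (s i * s (i + 1)) = R at *
  have hLS : (2 - 2 * Real.cos (Real.pi / (k + 1 : ℕ))) * S ≤ X := by linarith
  have hL : 0 ≤ 2 - 2 * Real.cos (Real.pi / (k + 1 : ℕ)) := by
    linarith [Real.cos_le_one (Real.pi / (k + 1 : ℕ))]
  generalize 2 - 2 * Real.cos (Real.pi / (k + 1 : ℕ)) = L at *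
  rcases le_or_gt X 0 with h | h
  · exact (mul_nonpos_of_nonneg_of_nonpos hL h).trans hX0
  · refine le_of_mul_le_mul_right ?_ h
    nlinarith [mul_le_mul_of_nonneg_left hCS hL, mul_le_mul_of_nonneg_right hLS hX0]

/-! ### Vertex connectivity, degrees and edge cuts. -/

section VertexConnectivity

variable {V : Type*} [Fintype V] (G : SimpleGraph V)

theorem vertexConnectivity_le_of_not_connected (S : Finset V)
    (hS : ¬ (G.induce ((S : Set V)ᶜ)).Connected ∨ Fintype.card V ≤ S.card + 1) :
    vertexConnectivity G ≤ S.card :=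
  Nat.sInf_le ⟨S, rfl, hS⟩

theorem vertexConnectivity_le_card_sub_one :
    vertexConnectivity G ≤ Fintype.card V - 1 := by
  classical
  obtain ⟨S, -, hS⟩ := exists_subset_card_eq (s := (univ : Finset V))
    (n := Fintype.card V - 1) (by rw [card_univ]; omega)
  rw [← hS]
  exact vertexConnectivity_le_of_not_connected G S (Or.inr (by omega))

/-- A set closed under adjacency in an induced subgraph, containing one vertex but not
another, witnesses that the subgraph is disconnected. -/
theorem SimpleGraph.not_connected_of_closed {W : Type*} (G : SimpleGraph W) (P : W → Prop)
    (hP : ∀ u v, G.Adj u v → P u → P v) {a b : W} (ha : P a) (hb : ¬ P b) :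
    ¬ G.Connected := by
  intro hc
  obtain ⟨p⟩ := hc.preconnected a b
  have key : ∀ {u v : W}, G.Walk u v → P u → P v := by
    intro u v q
    induction q with
    | nil => exact id
    | cons h _ ih => exact fun hu => ih (hP _ _ h hu)
  exact hb (key p ha)

/-- Deleting the neighbours of `v` isolates it, or leaves `v` alone when it is adjacent to every
other vertex. -/
theorem vertexConnectivity_le_degree [DecidableRel G.Adj] (v : V) :
    vertexConnectivity G ≤ G.degree v := by
  classical
  rw [← G.card_neighborFinset_eq_degree]
  refine vertexConnectivity_le_of_not_connected G _ ?_
  by_cases h : ∃ b, b ≠ v ∧ ¬ G.Adj v b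
  · obtain ⟨b, hbv, hb⟩ := h
    left
    refine SimpleGraph.not_connected_of_closed _ (fun u => (u : V) = v)
      (a := ⟨v, by simp⟩) (b := ⟨b, by simpa using hb⟩) ?_ rfl hbv
    rintro ⟨u, hu⟩ ⟨w, hw⟩ huw (huv : u = v)
    subst huv
    exact absurd huw (by simpa using hw)
  · right
    push Not at h
    have : (univ : Finset V) ⊆ insert v (G.neighborFinset v) := by
      intro b _
      by_cases hb : b = v
      · simp [hb]
      · simp [h b hb]
    exact (card_le_card this).trans (card_insert_le _ _)

/-- Whitney's inequality in the form needed for cuts: every edge cut has at least as many edges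
as the vertex connectivity. -/
theorem vertexConnectivity_le_card_cut [DecidableRel G.Adj] (A : V → Prop) [DecidablePred A]
    (hA : ∃ a, A a) (hB : ∃ b, ¬ A b) :
    vertexConnectivity G ≤
      #{p : V × V | G.Adj p.1 p.2 ∧ A p.1 ∧ ¬ A p.2} := by
  classical
  -- If all cross pairs are edges, the cut has `|A| |Aᶜ| ≥ |A| + |Aᶜ| - 1` edges.
  by_cases hfull : ∀ a b, A a → ¬ A b → G.Adj a b
  · refine (vertexConnectivity_le_card_sub_one G).trans ?_
    have hsub : (univ.filter A) ×ˢ (univ.filter fun b => ¬ A b) ⊆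
        ({p : V × V | G.Adj p.1 p.2 ∧ A p.1 ∧ ¬ A p.2} : Finset (V × V)) := by
      rintro ⟨a, b⟩ h
      simp only [mem_product, mem_filter, mem_univ, true_and] at h ⊢
      exact ⟨hfull a b h.1 h.2, h⟩
    refine le_trans ?_ (card_le_card hsub)
    rw [card_product, ← card_univ, ← card_filter_add_card_filter_not (s := univ) A]
    have h1 : 0 < #(univ.filter A) := card_pos.2 (by simpa [Finset.Nonempty] using hA)
    have h2 : 0 < #(univ.filter fun b => ¬ A b) :=
      card_pos.2 (by simpa [Finset.Nonempty] using hB)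
    generalize #(univ.filter A) = x at *
    generalize #(univ.filter fun b => ¬ A b) = y at *
    obtain ⟨x, rfl⟩ : ∃ t, x = t + 1 := ⟨x - 1, by omega⟩
    obtain ⟨y, rfl⟩ : ∃ t, y = t + 1 := ⟨y - 1, by omega⟩
    have : (x + 1) * (y + 1) = x * y + x + y + 1 := by ring
    have : 0 ≤ x * y := Nat.zero_le _
    omega
  · push Not at hfull
    obtain ⟨a, b, ha, hb, hab⟩ := hfull
    set C : Finset (V × V) := {p : V × V | G.Adj p.1 p.2 ∧ A p.1 ∧ ¬ A p.2} with hC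
    -- One endpoint per cut edge is deleted: the one in `A`, unless it is `a`. Non-adjacency of `a`
    -- and `b` ensures that both survive, on opposite sides.
    let r : V × V → V := fun p => if p.1 = a then p.2 else p.1
    refine le_trans (vertexConnectivity_le_of_not_connected G (C.image r) (Or.inl ?_))
      card_image_le
    have haS : a ∈ ((C.image r : Finset V) : Set V)ᶜ := by
      simp only [coe_image, Set.mem_compl_iff, Set.mem_image, not_exists, not_and]
      rintro ⟨u, v⟩ huv hr
      simp only [hC, coe_filter, mem_univ, true_and, Set.mem_ofPred_eq] at huv
      simp only [r] at hr
      split_ifs at hr with h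
      · exact huv.2.2 (hr ▸ ha)
      · exact h hr
    have hbS : b ∈ ((C.image r : Finset V) : Set V)ᶜ := by
      simp only [coe_image, Set.mem_compl_iff, Set.mem_image, not_exists, not_and]
      rintro ⟨u, v⟩ huv hr
      simp only [hC, coe_filter, mem_univ, true_and, Set.mem_ofPred_eq] at huv
      simp only [r] at hr
      split_ifs at hr with h
      · subst h hr
        exact hab huv.1
      · exact hb (hr ▸ huv.2.1)
    refine SimpleGraph.not_connected_of_closed _ (fun u => A u)
      (a := ⟨a, haS⟩) (b := ⟨b, hbS⟩) ?_ ha hb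
    rintro ⟨u, hu⟩ ⟨v, hv⟩ huv hAu
    by_contra hAv
    have hmem : (u, v) ∈ C := by
      simp only [hC, mem_filter, mem_univ, true_and]
      exact ⟨huv, hAu, hAv⟩
    by_cases h : u = a
    · exact hv (by simpa [r, h] using mem_image_of_mem r hmem)
    · exact hu (by simpa [r, h] using mem_image_of_mem r hmem)

end VertexConnectivity

/-- A monotone sequence satisfies `∑ (increments)² ≤ (total increment)²`. -/
theorem sum_sq_increment_le_sq {a : ℕ → ℝ} {i j n : ℕ} (hj : j < n)
    (ha : ∀ l, l + 1 < n → a l ≤ a (l + 1)) (hij : i ≤ j) :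
    ∑ l ∈ Ico i j, (a (l + 1) - a l) ^ 2 ≤ (a j - a i) ^ 2 ∧ a i ≤ a j := by
  induction j, hij using Nat.le_induction with
  | base => simp
  | succ j hij ih =>
    obtain ⟨h1, h2⟩ := ih (by omega)
    have h3 := ha j hj
    rw [sum_Ico_succ_top hij]
    refine ⟨?_, h2.trans h3⟩
    nlinarith [mul_nonneg (sub_nonneg.2 h2) (sub_nonneg.2 h3)]

theorem exists_equiv_fin_monotone {V : Type*} [Fintype V] {n : ℕ} (hn : Fintype.card V = n)
    (x : V → ℝ) : ∃ e : Fin n ≃ V, Monotone (x ∘ e) := by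
  let e₀ := (Fintype.equivFinOfCardEq hn).symm
  exact ⟨(Tuple.sort (x ∘ e₀)).trans e₀, Tuple.monotone_sort (x ∘ e₀)⟩

/-! ### Laplacian quadratic forms and Fiedler's bound. -/

section Laplacian

variable {V : Type*} [Fintype V] [DecidableEq V] (G : SimpleGraph V) [DecidableRel G.Adj]

open Matrix

theorem dotProduct_lapMatrix_mulVec (x : V → ℝ) :
    x ⬝ᵥ (G.lapMatrix ℝ *ᵥ x) =
      (∑ i : V, ∑ j : V, if G.Adj i j then (x i - x j) ^ 2 else 0) / 2 := by
  rw [← G.lapMatrix_toLinearMap₂' ℝ x, Matrix.toLinearMap₂'_apply']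

theorem dotProduct_lapMatrix_mulVec_le {Δ : ℕ} (hΔ : ∀ v, G.degree v ≤ Δ) (x : V → ℝ) :
    x ⬝ᵥ (G.lapMatrix ℝ *ᵥ x) ≤ 2 * Δ * ∑ i, x i ^ 2 := by
  rw [dotProduct_lapMatrix_mulVec]
  have h1 : ∑ i : V, ∑ j : V, (if G.Adj i j then (x i - x j) ^ 2 else 0) ≤
      ∑ i : V, ∑ j : V, ((if G.Adj i j then 2 * x i ^ 2 else 0)
        + (if G.Adj i j then 2 * x j ^ 2 else 0)) := by
    refine sum_le_sum fun i _ => sum_le_sum fun j _ => ?_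
    split_ifs
    · nlinarith [sq_nonneg (x i + x j)]
    · simp
  have h2 : ∑ i : V, ∑ j : V, (if G.Adj i j then 2 * x j ^ 2 else 0)
      = ∑ i : V, ∑ j : V, (if G.Adj i j then 2 * x i ^ 2 else 0) := by
    rw [sum_comm]
    simp_rw [G.adj_comm]
  have h3 : ∑ i : V, ∑ j : V, (if G.Adj i j then 2 * x i ^ 2 else 0)
      ≤ 2 * Δ * ∑ i, x i ^ 2 := by
    rw [mul_sum]
    refine sum_le_sum fun i _ => ?_
    have : ∑ j : V, (if G.Adj i j then 2 * x i ^ 2 else 0) = G.degree i * (2 * x i ^ 2) := by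
      rw [G.degree_eq_sum_if_adj, sum_mul]
      simp_rw [ite_mul, one_mul, zero_mul]
    rw [this]
    have hd : (G.degree i : ℝ) ≤ Δ := by exact_mod_cast hΔ i
    nlinarith [mul_le_mul_of_nonneg_right hd (sq_nonneg (x i))]
  simp_rw [sum_add_distrib] at h1
  linarith

/-- Fiedler's lower bound for the algebraic connectivity, with the vertex connectivity. -/
theorem fiedler_bound (x : V → ℝ) (hx : ∑ i, x i = 0) :
    4 * (vertexConnectivity G : ℝ) * Real.sin (Real.pi / (2 * Fintype.card V)) ^ 2
      * ∑ i, x i ^ 2 ≤ x ⬝ᵥ (G.lapMatrix ℝ *ᵥ x) := by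
  obtain ⟨n, hn⟩ : ∃ n, Fintype.card V = n := ⟨_, rfl⟩
  obtain ⟨e, he⟩ := exists_equiv_fin_monotone hn x
  rw [hn]
  rcases Nat.eq_zero_or_pos n with h0 | hpos
  · have : IsEmpty V := Fintype.card_eq_zero_iff.1 (hn.trans h0)
    simp [dotProduct]
  let a : ℕ → ℝ := fun l => if h : l < n then x (e ⟨l, h⟩) else 0
  have ha : ∀ v, a (e.symm v) = x v := fun v => by simp [a]
  have hmono : ∀ l, l + 1 < n → a l ≤ a (l + 1) := by
    intro l hl
    simp only [a, hl, show l < n by omega, dite_true]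
    exact he (Fin.mk_le_mk.2 (Nat.le_succ l))
  have hsum : ∀ F : ℝ → ℝ, ∑ l ∈ range n, F (a l) = ∑ v, F (x v) := by
    intro F
    rw [← Fin.sum_univ_eq_sum_range (fun l => F (a l)), ← Equiv.sum_comp e.symm
      (fun i : Fin n => F (a i))]
    simp_rw [ha]
  have hW := sin_sq_mul_sum_sq_le_sum_diff_sq hpos a (by rw [hsum fun t => t]; exact hx)
  rw [hsum fun t => t ^ 2] at hW
  set pos : V → ℕ := fun v => (e.symm v : ℕ) with hposn
  have hposlt : ∀ v, pos v < n := fun v => (e.symm v).2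
  have hpinj : ∀ u v, pos u = pos v → u = v := fun u v h => e.symm.injective (Fin.ext h)
  -- Each edge is counted once, oriented by increasing rank.
  have hhalf : x ⬝ᵥ (G.lapMatrix ℝ *ᵥ x) =
      ∑ p : V × V, if G.Adj p.1 p.2 ∧ pos p.1 < pos p.2 then (x p.2 - x p.1) ^ 2 else 0 := by
    rw [dotProduct_lapMatrix_mulVec, Fintype.sum_prod_type, div_eq_iff two_ne_zero, mul_two]
    conv_rhs => arg 2; rw [sum_comm]
    simp_rw [← sum_add_distrib]
    refine sum_congr rfl fun u _ => sum_congr rfl fun v _ => ?_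
    by_cases huv : G.Adj u v
    · have hvu := huv.symm
      rcases lt_trichotomy (pos u) (pos v) with h | h | h
      · simp [huv, hvu, h, h.not_gt]; ring
      · exact absurd (hpinj _ _ h) huv.ne
      · simp [huv, hvu, h, h.not_gt]
    · have hvu : ¬ G.Adj v u := fun h => huv h.symm
      simp [huv, hvu]
  -- An edge crosses every threshold between its two ranks, and its squared difference dominates the
  -- sum of the squared increments there.
  have hstep : ∑ p : V × V, ∑ l ∈ range (n - 1),
      (if G.Adj p.1 p.2 ∧ pos p.1 ≤ l ∧ ¬ pos p.2 ≤ l then (a (l + 1) - a l) ^ 2 else 0)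
      ≤ x ⬝ᵥ (G.lapMatrix ℝ *ᵥ x) := by
    rw [hhalf]
    refine sum_le_sum ?_
    rintro ⟨u, v⟩ -
    by_cases huv : G.Adj u v ∧ pos u < pos v
    · rw [if_pos huv, ← ha u, ← ha v]
      refine le_trans (le_of_eq ?_)
        (sum_sq_increment_le_sq (hposlt v) hmono huv.2.le).1
      rw [← sum_filter]
      refine sum_congr ?_ fun _ _ => rfl
      ext l
      have := hposlt v
      simp only [mem_filter, mem_range, mem_Ico, huv.1, true_and]
      omega
    · rw [if_neg huv]
      refine le_of_eq (sum_eq_zero fun l _ => if_neg ?_)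
      rintro ⟨h1, h2, h3⟩
      exact huv ⟨h1, by simp only at h2 h3; omega⟩
  -- Cutting by rank rather than by value handles ties; `l < n - 1` keeps both sides nonempty.
  have hcut : ∀ l ∈ range (n - 1), (vertexConnectivity G : ℝ) * (a (l + 1) - a l) ^ 2 ≤
      ∑ p : V × V,
      (if G.Adj p.1 p.2 ∧ pos p.1 ≤ l ∧ ¬ pos p.2 ≤ l then (a (l + 1) - a l) ^ 2 else 0) := by
    intro l hl
    rw [mem_range] at hl
    rw [← sum_filter, sum_const, nsmul_eq_mul]
    refine mul_le_mul_of_nonneg_right ?_ (sq_nonneg _)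
    exact_mod_cast vertexConnectivity_le_card_cut G (fun v => pos v ≤ l)
      ⟨e ⟨0, by omega⟩, by simp [pos]⟩ ⟨e ⟨l + 1, by omega⟩, by simp [pos]⟩
  rw [sum_comm] at hstep
  have hfin := (sum_le_sum hcut).trans hstep
  rw [← mul_sum] at hfin
  refine le_trans ?_ hfin
  have := mul_le_mul_of_nonneg_left hW (Nat.cast_nonneg (α := ℝ) (vertexConnectivity G))
  linarith

end Laplacian

/-! ### Unit-circle vectors and their real encoding. -/

section Vectors

variable {V : Type*}

theorem norm_angular (t : V → ℝ) (i : V) : ‖angular t i‖ = 1 := by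
  have : 2 * (Real.pi : ℂ) * Complex.I * (t i : ℂ) = ((2 * Real.pi * t i : ℝ) : ℂ) * Complex.I := by
    push_cast; ring
  rw [angular, this, Complex.norm_exp_ofReal_mul_I]

theorem norm_angular_sub_le (t : V → ℝ) (i j : V) :
    ‖angular t i - angular t j‖ ≤ 2 * Real.pi * |t i - t j| := by
  have : angular t i - angular t j = angular t j *
      (Complex.exp (Complex.I * ((2 * Real.pi * (t i - t j) : ℝ) : ℂ)) - 1) := by
    rw [mul_sub, mul_one, angular, angular, ← Complex.exp_add]
    congr 2
    push_cast
    ring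
  rw [this, norm_mul, norm_angular, one_mul]
  refine Real.norm_exp_I_mul_ofReal_sub_one_le.trans (le_of_eq ?_)
  rw [Real.norm_eq_abs, abs_mul, abs_of_pos Real.two_pi_pos]

theorem norm_sq_realVec [Fintype V] (g : V → ℂ) : ‖realVec g‖ ^ 2 = ∑ i, ‖g i‖ ^ 2 := by
  rw [EuclideanSpace.norm_sq_eq, Fintype.sum_sum_type, ← sum_add_distrib]
  refine sum_congr rfl fun i _ => ?_
  rw [Complex.sq_norm, Complex.normSq_apply]
  simp [realVec, sq]

theorem norm_sq_realVec_angular [Fintype V] (t : V → ℝ) :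
    ‖realVec (angular t)‖ ^ 2 = Fintype.card V := by
  simp [norm_sq_realVec, norm_angular]

theorem quadForm_eq_inner [Fintype V] [DecidableEq V] (A : Matrix V V ℝ)
    (g : EuclideanSpace ℝ V) : quadForm A g = inner ℝ g (Matrix.toEuclideanLin A g) := by
  rw [quadForm, EuclideanSpace.inner_eq_star_dotProduct, Matrix.ofLp_toLpLin, Matrix.toLin'_apply,
    star_trivial, dotProduct_comm]

theorem norm_sq_eq_sum_inl_add_sum_inr [Fintype V] (g : EuclideanSpace ℝ (V ⊕ V)) :
    ‖g‖ ^ 2 = ∑ i, g (Sum.inl i) ^ 2 + ∑ i, g (Sum.inr i) ^ 2 := by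
  simp [EuclideanSpace.norm_sq_eq, Fintype.sum_sum_type]

end Vectors

/-! ### The grid graph: degrees, spectral bounds and smoothness of the signal. -/

section Grid

variable {d m k : ℕ}

open Matrix

theorem card_gridIndex : Fintype.card (GridIndex d m) = m ^ d := by simp

/-- A closed neighbourhood lies in a product of one-dimensional windows. The bound `c` is `2k + 1`
for a general vertex and `k + 1` at a corner. -/
theorem degree_chebyshevGraph_add_one_le (v : GridIndex d m) (c : ℕ)
    (hc : ∀ a, #{x : Fin m | |((v a : ℕ) : ℤ) - ((x : ℕ) : ℤ)| ≤ (k : ℤ)} ≤ c) :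
    (chebyshevGraph d m k).degree v + 1 ≤ c ^ d := by
  have hsub : insert v ((chebyshevGraph d m k).neighborFinset v) ⊆
      Fintype.piFinset fun a => {x : Fin m | |((v a : ℕ) : ℤ) - ((x : ℕ) : ℤ)| ≤ (k : ℤ)} := by
    intro w hw
    rw [Fintype.mem_piFinset]
    intro a
    rw [mem_filter]
    refine ⟨mem_univ _, ?_⟩
    rcases mem_insert.1 hw with rfl | hw
    · simp
    · rw [SimpleGraph.mem_neighborFinset] at hw
      exact hw.2 a
  have h1 := card_le_card hsub
  rw [card_insert_of_notMem (by simp), SimpleGraph.card_neighborFinset_eq_degree,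
    Fintype.card_piFinset] at h1
  exact h1.trans ((prod_le_pow_card _ _ _ fun a _ => hc a).trans (by simp))

theorem degree_chebyshevGraph_le (v : GridIndex d m) :
    (chebyshevGraph d m k).degree v ≤ (2 * k + 1) ^ d - 1 := by
  refine Nat.le_sub_one_of_lt (degree_chebyshevGraph_add_one_le v _ fun a => ?_)
  have : #(Icc (((v a : ℕ) : ℤ) - k) ((v a : ℕ) + k)) = 2 * k + 1 := by
    rw [Int.card_Icc]; omega
  rw [← this]
  refine card_le_card_of_injOn (fun x : Fin m => ((x : ℕ) : ℤ)) ?_ ?_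
  · intro x hx
    simp only [coe_filter, mem_univ, true_and, Set.mem_ofPred_eq, abs_le] at hx
    simp only [coe_Icc, Set.mem_Icc]
    omega
  · intro x _ y _ hxy
    simpa [Fin.ext_iff] using hxy

theorem natCast_succ_pow_sub_one (b d : ℕ) :
    (((b + 1) ^ d - 1 : ℕ) : ℝ) = ((b : ℝ) + 1) ^ d - 1 := by
  rw [Nat.cast_sub (Nat.one_le_pow _ _ (Nat.succ_pos b))]
  push_cast
  ring

theorem natCast_degree_bound (k d : ℕ) :
    (((2 * k + 1) ^ d - 1 : ℕ) : ℝ) = (2 * (k : ℝ) + 1) ^ d - 1 := by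
  rw [natCast_succ_pow_sub_one]
  push_cast
  ring

/-- At the corner vertex all windows are one-sided. -/
theorem vertexConnectivity_chebyshevGraph_le (hm : 0 < m) :
    vertexConnectivity (chebyshevGraph d m k) ≤ (k + 1) ^ d - 1 := by
  refine (vertexConnectivity_le_degree _ (fun _ => ⟨0, hm⟩)).trans
    (Nat.le_sub_one_of_lt (degree_chebyshevGraph_add_one_le _ _ fun a => ?_))
  rw [← card_range (k + 1)]
  refine card_le_card_of_injOn (fun x : Fin m => (x : ℕ)) ?_ ?_
  · intro x hx
    simp only [coe_filter, mem_univ, true_and, Set.mem_ofPred_eq, abs_le] at hx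
    simp only [coe_range, Set.mem_Iio]
    omega
  · intro x _ y _ hxy
    simpa [Fin.ext_iff] using hxy

theorem gridPoint_mem_Icc (hm : 2 ≤ m) (i : GridIndex d m) (a : Fin d) :
    gridPoint i a ∈ Set.Icc (0 : ℝ) 1 := by
  have h1 : (2 : ℝ) ≤ m := by exact_mod_cast hm
  have h2 : ((i a : ℕ) : ℝ) + 1 ≤ m := by exact_mod_cast (i a).2
  simp only [gridPoint]
  exact ⟨div_nonneg (Nat.cast_nonneg _) (by linarith),
    (div_le_one (by linarith)).2 (by linarith)⟩

theorem norm_gridPoint_sub_le (hm : 2 ≤ m) {i j : GridIndex d m}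
    (hij : (chebyshevGraph d m k).Adj i j) :
    ‖gridPoint i - gridPoint j‖ ≤ k * Real.sqrt d / ((m : ℝ) - 1) := by
  have h1 : (2 : ℝ) ≤ m := by exact_mod_cast hm
  have hm1 : (0 : ℝ) < m - 1 := by linarith
  refine abs_le_of_sq_le_sq' ?_ (by positivity) |>.2
  rw [EuclideanSpace.norm_sq_eq, div_pow, mul_pow, Real.sq_sqrt (Nat.cast_nonneg _)]
  have : ∀ a : Fin d, ‖(gridPoint i - gridPoint j) a‖ ^ 2 ≤ (k : ℝ) ^ 2 / ((m : ℝ) - 1) ^ 2 := by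
    intro a
    have h2 : |((i a : ℕ) : ℝ) - ((j a : ℕ) : ℝ)| ≤ k := by exact_mod_cast hij.2 a
    simp only [PiLp.sub_apply, gridPoint, Real.norm_eq_abs, ← sub_div, sq_abs, div_pow]
    refine div_le_div_of_nonneg_right ?_ (sq_nonneg _)
    rw [← sq_abs]
    exact pow_le_pow_left₀ (abs_nonneg _) h2 2
  refine (sum_le_sum fun a _ => this a).trans (le_of_eq ?_)
  simp
  ring

theorem quadForm_blockLaplacian (lam : ℝ) (g : EuclideanSpace ℝ (GridIndex d m ⊕ GridIndex d m)) :
    quadForm (blockLaplacian d m k lam) g =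
      lam * ((fun i => g (Sum.inl i)) ⬝ᵥ
          ((chebyshevGraph d m k).lapMatrix ℝ *ᵥ fun i => g (Sum.inl i))
        + (fun i => g (Sum.inr i)) ⬝ᵥ
          ((chebyshevGraph d m k).lapMatrix ℝ *ᵥ fun i => g (Sum.inr i))) := by
  rw [quadForm, blockLaplacian, fromBlocks_mulVec, dotProduct, Fintype.sum_sum_type]
  simp only [Sum.elim_inl, Sum.elim_inr, zero_mulVec, add_zero, zero_add, smul_mulVec]
  simp only [dotProduct, Pi.smul_apply, smul_eq_mul, mul_add, mul_sum]
  congr 1 <;> refine sum_congr rfl fun i _ => ?_ <;> rw [mul_left_comm] <;> rfl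

theorem isPositive_blockLaplacian {lam : ℝ} (hlam : 0 ≤ lam) :
    (toEuclideanLin (blockLaplacian d m k lam)).IsPositive := by
  rw [isPositive_toEuclideanLin_iff]
  have hL := ((chebyshevGraph d m k).posSemidef_lapMatrix ℝ)
  refine .of_dotProduct_mulVec_nonneg ?_ fun x => ?_
  · rw [blockLaplacian, IsHermitian, fromBlocks_conjTranspose, conjTranspose_smul,
      hL.isHermitian.eq]
    simp
  · rw [star_trivial]
    have := quadForm_blockLaplacian (k := k) lam (WithLp.toLp 2 x)
    rw [quadForm] at this
    refine le_of_le_of_eq ?_ this.symm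
    refine mul_nonneg hlam (add_nonneg ?_ ?_)
    · simpa using hL.dotProduct_mulVec_nonneg fun i => x (Sum.inl i)
    · simpa using hL.dotProduct_mulVec_nonneg fun i => x (Sum.inr i)

theorem quadForm_blockLaplacian_le {lam : ℝ} (hlam : 0 ≤ lam)
    (g : EuclideanSpace ℝ (GridIndex d m ⊕ GridIndex d m)) :
    quadForm (blockLaplacian d m k lam) g ≤
      2 * lam * ((2 * (k : ℝ) + 1) ^ d - 1) * ‖g‖ ^ 2 := by
  rw [quadForm_blockLaplacian, norm_sq_eq_sum_inl_add_sum_inr, ← natCast_degree_bound]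
  have h1 := dotProduct_lapMatrix_mulVec_le (chebyshevGraph d m k)
    degree_chebyshevGraph_le fun i => g (Sum.inl i)
  have h2 := dotProduct_lapMatrix_mulVec_le (chebyshevGraph d m k)
    degree_chebyshevGraph_le fun i => g (Sum.inr i)
  have := mul_le_mul_of_nonneg_left (add_le_add h1 h2) hlam
  linarith

/-- On the orthogonal complement of the null space, the regularizer is bounded below through
Fiedler's inequality. -/
theorem le_quadForm_blockLaplacian {lam : ℝ} (hlam : 0 ≤ lam)
    {g : EuclideanSpace ℝ (GridIndex d m ⊕ GridIndex d m)}
    (hg : g ∈ (nullSpace (blockLaplacian d m k lam))ᗮ) :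
    4 * lam * (vertexConnectivity (chebyshevGraph d m k) : ℝ)
      * Real.sin (Real.pi / (2 * (m : ℝ) ^ d)) ^ 2 * ‖g‖ ^ 2 ≤
      quadForm (blockLaplacian d m k lam) g := by
  -- Block-constant vectors suffice: orthogonality to them makes each block sum to zero, so neither
  -- connectedness nor `λ ≠ 0` is needed.
  have hker : ∀ α β : ℝ, WithLp.toLp 2 (Sum.elim (fun _ => α) (fun _ => β)) ∈
      nullSpace (blockLaplacian d m k lam) := by
    intro α β
    have hconst : ∀ c : ℝ, (chebyshevGraph d m k).lapMatrix ℝ *ᵥ (fun _ => c) = 0 := by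
      intro c
      have : (fun _ : GridIndex d m => c) = c • (fun _ => (1 : ℝ)) := by ext; simp
      rw [this, mulVec_smul, SimpleGraph.lapMatrix_mulVec_const_eq_zero, smul_zero]
    rw [nullSpace, LinearMap.mem_ker, toLpLin_toLp, toLin'_apply, blockLaplacian,
      fromBlocks_mulVec]
    simp [Sum.elim_comp_inl, Sum.elim_comp_inr, smul_mulVec, hconst]
  have hl : ∑ i, g (Sum.inl i) = 0 := by
    have := hg _ (hker 1 0)
    simpa [PiLp.inner_apply, Fintype.sum_sum_type] using this
  have hr : ∑ i, g (Sum.inr i) = 0 := by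
    have := hg _ (hker 0 1)
    simpa [PiLp.inner_apply, Fintype.sum_sum_type] using this
  have h1 := fiedler_bound (chebyshevGraph d m k) _ hl
  have h2 := fiedler_bound (chebyshevGraph d m k) _ hr
  rw [card_gridIndex, Nat.cast_pow] at h1 h2
  rw [quadForm_blockLaplacian, norm_sq_eq_sum_inl_add_sum_inr]
  have := mul_le_mul_of_nonneg_left (add_le_add h1 h2) hlam
  linarith

/-- The regularizer is small at the angular image of a Hölder function. -/
theorem quadForm_angular_le (hm : 2 ≤ m) {M α lam : ℝ} (hM : 0 < M) (hα : 0 < α)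
    (hlam : 0 ≤ lam) {f : EuclideanSpace ℝ (Fin d) → ℝ} (hf : HolderOnCube f M α) :
    quadForm (blockLaplacian d m k lam) (realVec (angular fun i => f (gridPoint i))) ≤
      2 * lam * Real.pi ^ 2 * M ^ 2 * ((k * Real.sqrt d / ((m : ℝ) - 1)) ^ α) ^ 2
        * ((2 * (k : ℝ) + 1) ^ d - 1) * (m : ℝ) ^ d := by
  set t : GridIndex d m → ℝ := fun i => f (gridPoint i) with ht
  -- The squared chord bound along one edge: chord at most arc, then Hölder at the largest Euclidean
  -- length of an edge.
  set B : ℝ := (2 * Real.pi * (M * (k * Real.sqrt d / ((m : ℝ) - 1)) ^ α)) ^ 2 with hB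
  have hadj : ∀ i j, (chebyshevGraph d m k).Adj i j →
      ((angular t i).re - (angular t j).re) ^ 2 + ((angular t i).im - (angular t j).im) ^ 2
        ≤ B := by
    intro i j hij
    have h1 : |t i - t j| ≤ M * (k * Real.sqrt d / ((m : ℝ) - 1)) ^ α :=
      (hf _ _ (gridPoint_mem_Icc hm i) (gridPoint_mem_Icc hm j)).trans
        (mul_le_mul_of_nonneg_left
          (Real.rpow_le_rpow (norm_nonneg _) (norm_gridPoint_sub_le hm hij) hα.le) hM.le)
    have h2 := (norm_angular_sub_le t i j).trans
      (mul_le_mul_of_nonneg_left h1 Real.two_pi_pos.le)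
    have h3 := pow_le_pow_left₀ (norm_nonneg _) h2 2
    rw [Complex.sq_norm, Complex.normSq_apply, Complex.sub_re, Complex.sub_im] at h3
    rw [hB]
    linarith
  have hdeg : ∀ i, ((chebyshevGraph d m k).degree i : ℝ) ≤ (2 * (k : ℝ) + 1) ^ d - 1 := by
    intro i
    rw [← natCast_degree_bound]
    exact_mod_cast degree_chebyshevGraph_le i
  have hsum : ∑ i, ∑ j, (if (chebyshevGraph d m k).Adj i j then B else 0) ≤
      (m : ℝ) ^ d * (((2 * (k : ℝ) + 1) ^ d - 1) * B) := by
    have : ∀ i, ∑ j, (if (chebyshevGraph d m k).Adj i j then B else 0) ≤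
        ((2 * (k : ℝ) + 1) ^ d - 1) * B := by
      intro i
      refine le_trans (le_of_eq ?_) (mul_le_mul_of_nonneg_right (hdeg i) (sq_nonneg _))
      rw [SimpleGraph.degree_eq_sum_if_adj, sum_mul]
      simp_rw [ite_mul, one_mul, zero_mul]
    refine (sum_le_sum fun i _ => this i).trans (le_of_eq ?_)
    rw [sum_const, card_univ, card_gridIndex, nsmul_eq_mul, Nat.cast_pow]
  rw [quadForm_blockLaplacian, dotProduct_lapMatrix_mulVec, dotProduct_lapMatrix_mulVec,
    ← add_div, ← sum_add_distrib]
  simp_rw [← sum_add_distrib]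
  have hle := (sum_le_sum fun i (_ : i ∈ univ) => sum_le_sum fun j (_ : j ∈ univ) =>
    show ((if (chebyshevGraph d m k).Adj i j then
          (realVec (angular t) (Sum.inl i) - realVec (angular t) (Sum.inl j)) ^ 2 else 0)
        + (if (chebyshevGraph d m k).Adj i j then
          (realVec (angular t) (Sum.inr i) - realVec (angular t) (Sum.inr j)) ^ 2 else 0))
        ≤ if (chebyshevGraph d m k).Adj i j then B else 0 by
      split_ifs with h
      · exact hadj i j h
      · simp).trans hsum
  refine (mul_le_mul_of_nonneg_left (div_le_div_of_nonneg_right hle two_pos.le) hlam).trans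
    (le_of_eq ?_)
  rw [hB]
  ring

end Grid

end

/-! ### Stability and uniqueness for the trust-region problem. -/

section TrustRegion

variable {E : Type*} [NormedAddCommGroup E] [InnerProductSpace ℝ E] {T : E →ₗ[ℝ] E}

/-- The stability estimate for a solution `g = (T + μ)⁻¹ z` of the trust-region problem. -/
theorem LinearMap.IsPositive.le_inner_of_shift_eq (hT : T.IsPositive) {Λ μ ν δ n : ℝ}
    (hΛ₀ : 0 ≤ Λ) (hΛ : ∀ x, inner ℝ x (T x) ≤ Λ * ‖x‖ ^ 2) (hμ : 0 < μ) (hμν : μ ≤ ν)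
    (hδ₀ : 0 ≤ δ) (hδ₁ : δ ≤ 1) (hn : 0 < n) {g h z : E} (hg : T g + μ • g = z)
    (hgn : ‖g‖ ^ 2 = n) (hhn : ‖h‖ ^ 2 = n) (hzn : ‖z‖ ^ 2 = n)
    (hnoise : ‖z - h‖ ≤ δ * Real.sqrt n) :
    1 - 3 * δ / 2 - 1 / (2 * n) * inner ℝ h (T h)
      + 1 / (Λ + ν) ^ 2 * (1 / (2 * n) * inner ℝ z (T z)) ≤ 1 / n * inner ℝ h g := by
  have hid := hT.trust_region_identity hg (hhn.trans hgn.symm)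
  have h0 : 0 ≤ inner ℝ (h - g) (T (h - g)) := by
    rw [real_inner_comm]
    exact hT.re_inner_nonneg_left _
  have h0g : 0 ≤ inner ℝ g (T g) := by
    rw [real_inner_comm]
    exact hT.re_inner_nonneg_left _
  have hs : Real.sqrt n ^ 2 = n := Real.sq_sqrt hn.le
  have hgs : ‖g‖ = Real.sqrt n := by rw [← hgn, Real.sqrt_sq (norm_nonneg _)]
  have h1 : inner ℝ (z - h) g ≤ δ * n := by
    refine (real_inner_le_norm _ _).trans ?_
    rw [hgs]
    calc ‖z - h‖ * Real.sqrt n ≤ δ * Real.sqrt n * Real.sqrt n :=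
          mul_le_mul_of_nonneg_right hnoise (Real.sqrt_nonneg _)
      _ = δ * n := by rw [mul_assoc, ← sq, hs]
  -- Here `δ² ≤ δ`. Expanded, this costs `δ/2` in `⟨h, z⟩`; with the `δ` from `h1`, the total loss
  -- is `3δ/2`.
  have h2 : ‖z - h‖ ^ 2 ≤ δ * n := by
    have := pow_le_pow_left₀ (norm_nonneg _) hnoise 2
    rw [mul_pow, hs] at this
    exact this.trans (mul_le_mul_of_nonneg_right (by nlinarith) hn.le)
  rw [norm_sub_sq_real, hzn, hhn] at h2
  rw [inner_sub_left, real_inner_comm g z] at h1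
  rw [real_inner_comm z h] at hid
  have h3 : inner ℝ z (T z) ≤ (Λ + ν) ^ 2 * inner ℝ g (T g) := by
    have := hT.inner_shift_le hΛ₀ hΛ hμ.le g
    rw [hg] at this
    exact this.trans (mul_le_mul_of_nonneg_right
      (pow_le_pow_left₀ (by linarith) (by linarith) 2) h0g)
  have hpos : 0 < (Λ + ν) ^ 2 := by
    have : 0 < Λ + ν := by linarith
    positivity
  have h4 : 1 / (Λ + ν) ^ 2 * inner ℝ z (T z) ≤ inner ℝ g (T g) := by
    rw [one_div, inv_mul_le_iff₀ hpos]
    exact h3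
  have h5 : n - 3 * δ / 2 * n - inner ℝ h (T h) / 2 + 1 / (Λ + ν) ^ 2 * inner ℝ z (T z) / 2
      ≤ inner ℝ h g := by
    nlinarith [mul_nonneg hμ.le (sq_nonneg ‖h - g‖)]
  have h6 := mul_le_mul_of_nonneg_left h5 (one_div_nonneg.2 hn.le)
  refine le_trans (le_of_eq ?_) h6
  field_simp

end TrustRegion

theorem isTRSSolution_unique_of_shift_eq {ι : Type*} [Fintype ι] [DecidableEq ι]
    {A : Matrix ι ι ℝ} (hA : (Matrix.toEuclideanLin A).IsPositive) {μ n : ℝ} (hμ : 0 < μ)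
    {g z : EuclideanSpace ℝ ι} (hg : Matrix.toEuclideanLin A g + μ • g = z)
    (hgn : ‖g‖ ^ 2 = n) :
    IsTRSSolution A z n g ∧ ∀ g', IsTRSSolution A z n g' → g' = g := by
  have key : ∀ g' : EuclideanSpace ℝ ι, ‖g'‖ ^ 2 = n →
      quadForm A g - 2 * inner ℝ g z + μ * ‖g' - g‖ ^ 2 ≤ quadForm A g' - 2 * inner ℝ g' z := by
    intro g' hg'
    have h0 : 0 ≤ inner ℝ (g' - g) (Matrix.toEuclideanLin A (g' - g)) := by
      rw [real_inner_comm]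
      exact hA.re_inner_nonneg_left _
    rw [quadForm_eq_inner, quadForm_eq_inner,
      hA.trust_region_identity hg (hg'.trans hgn.symm)]
    linarith
  refine ⟨⟨hgn, fun g' hg' => ?_⟩, fun g' hg' => ?_⟩
  · linarith [key g' hg', mul_nonneg hμ.le (sq_nonneg ‖g' - g‖)]
  · have h1 := key g' hg'.1
    have h2 := hg'.2 g hgn
    have h3 : ‖g' - g‖ ^ 2 ≤ 0 := by
      by_contra! h
      nlinarith [mul_pos hμ h]
    have h4 : ‖g' - g‖ = 0 := pow_eq_zero_iff two_ne_zero |>.1 (le_antisymm h3 (sq_nonneg _))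
    exact sub_eq_zero.1 (norm_eq_zero.1 h4)

/-- Pairing the equation with a null vector `v` leaves `μ⟨v, g⟩ = ⟨v, z⟩ = 0`. -/
theorem mem_nullSpace_orthogonal_of_shift_eq {ι : Type*} [Fintype ι] [DecidableEq ι]
    {A : Matrix ι ι ℝ} (hA : (Matrix.toEuclideanLin A).IsPositive) {μ : ℝ} (hμ : 0 < μ)
    {g z : EuclideanSpace ℝ ι} (hg : Matrix.toEuclideanLin A g + μ • g = z)
    (hz : z ∈ (nullSpace A)ᗮ) : g ∈ (nullSpace A)ᗮ := by
  intro v hv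
  have h1 := hz v hv
  have h2 := hA.isSymmetric v g
  rw [nullSpace, LinearMap.mem_ker] at hv
  rw [hv, inner_zero_left] at h2
  rw [← hg, inner_add_right, inner_smul_right, ← h2, zero_add] at h1
  exact (mul_eq_zero.1 h1).resolve_left hμ.ne'

/-- Uses `√d ≤ d`, `m - 1 ≥ m/2` and `(m^d)^(2α/d) = m^(2α)`. -/
theorem grid_spacing_rpow_le {d m k : ℕ} (hd : 1 ≤ d) (hm : 2 ≤ m) {α : ℝ} (hα : 0 < α) :
    (((k : ℝ) * Real.sqrt d / ((m : ℝ) - 1)) ^ α) ^ 2 ≤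
      (2 * (k : ℝ)) ^ (2 * α) * (d : ℝ) ^ (2 * α) / ((m : ℝ) ^ d) ^ (2 * α / (d : ℝ)) := by
  have hd1 : (1 : ℝ) ≤ d := by exact_mod_cast hd
  have hm2 : (2 : ℝ) ≤ m := by exact_mod_cast hm
  have hm1 : (0 : ℝ) < m - 1 := by linarith
  have hsq : Real.sqrt d ≤ d := by
    rw [Real.sqrt_le_left (by linarith)]
    nlinarith
  have hbase : (k : ℝ) * Real.sqrt d / ((m : ℝ) - 1) ≤ 2 * k * d / m := by
    rw [div_le_div_iff₀ hm1 (by linarith)]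
    have h1 : (k : ℝ) * Real.sqrt d ≤ k * d := mul_le_mul_of_nonneg_left hsq (Nat.cast_nonneg _)
    have h2 : (0 : ℝ) ≤ k * d := by positivity
    nlinarith [mul_le_mul_of_nonneg_right h1 (show (0 : ℝ) ≤ m by linarith)]
  have e1 : ((m : ℝ) ^ d) ^ (2 * α / (d : ℝ)) = (m : ℝ) ^ (2 * α) := by
    rw [← Real.rpow_natCast, ← Real.rpow_mul (by linarith)]
    congr 1
    field_simp
  rw [e1, ← Real.mul_rpow (by positivity) (by positivity),
    ← Real.div_rpow (by positivity) (by linarith), ← Real.rpow_natCast, ← Real.rpow_mul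
      (by positivity), Nat.cast_two, mul_comm α 2]
  exact Real.rpow_le_rpow (by positivity) hbase (by linarith)

theorem theorem5 (d m k : ℕ) (hd : 1 ≤ d) (hm : 2 ≤ m) (hk : 1 ≤ k)
    (M α lam δ n : ℝ) (hM : 0 < M) (hα₀ : 0 < α) (hα₁ : α ≤ 1) (hlam : 0 ≤ lam)
    (hδ₀ : 0 ≤ δ) (hδ₁ : δ ≤ 1) (hn : n = (m : ℝ) ^ d)
    (f : EuclideanSpace ℝ (Fin d) → ℝ) (hf : HolderOnCube f M α)
    (η y : GridIndex d m → ℝ) (hy : ∀ i, y i = Int.fract (f (gridPoint i) + η i))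
    (h z : EuclideanSpace ℝ (GridIndex d m ⊕ GridIndex d m))
    (hh : h = realVec (angular fun i => f (gridPoint i)))
    (hz : z = realVec (angular y))
    (hnoise : ‖z - h‖ ≤ δ * Real.sqrt n)
    (H : Matrix (GridIndex d m ⊕ GridIndex d m) (GridIndex d m ⊕ GridIndex d m) ℝ)
    (hH : H = blockLaplacian d m k lam)
    (D κ : ℝ) (hD : D = (2 * (k : ℝ) + 1) ^ d - 1)
    (hκ : κ = (vertexConnectivity (chebyshevGraph d m k) : ℝ)) :
    (z ∉ (nullSpace H)ᗮ →
      ∃ g : EuclideanSpace ℝ (GridIndex d m ⊕ GridIndex d m),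
        IsTRSSolution H z n g ∧ (∀ g', IsTRSSolution H z n g' → g' = g) ∧
        1 / n * inner ℝ h g ≥
          1 - 3 * δ / 2
            - lam * Real.pi ^ 2 * M ^ 2 * (2 * (k : ℝ)) ^ (2 * α) * (d : ℝ) ^ (2 * α) * D
                / n ^ (2 * α / (d : ℝ))
            + 1 / (2 * lam * D + 1) ^ 2 * (1 / (2 * n) * quadForm H z)) ∧
    (z ∈ (nullSpace H)ᗮ → lam < 1 / (2 * D) →
      ∃ g : EuclideanSpace ℝ (GridIndex d m ⊕ GridIndex d m),
        IsTRSSolution H z n g ∧ (∀ g', IsTRSSolution H z n g' → g' = g) ∧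
        1 / n * inner ℝ h g ≥
          1 - 3 * δ / 2
            - lam * Real.pi ^ 2 * M ^ 2 * (2 * (k : ℝ)) ^ (2 * α) * (d : ℝ) ^ (2 * α) * D
                / n ^ (2 * α / (d : ℝ))
            + 1 / (1 + 2 * lam * D - 4 * lam * κ * Real.sin (Real.pi / (2 * n)) ^ 2) ^ 2
                * (1 / (2 * n) * quadForm H z)) ∧
    κ ≤ ((k : ℝ) + 1) ^ d - 1 := by
  have hm0 : (0 : ℝ) < m := by exact_mod_cast (by omega : 0 < m)
  have hn0 : 0 < n := hn ▸ pow_pos hm0 d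
  have hcard : ((Fintype.card (GridIndex d m) : ℕ) : ℝ) = n := by
    rw [card_gridIndex, Nat.cast_pow, hn]
  have hhn : ‖h‖ ^ 2 = n := by rw [hh, norm_sq_realVec_angular, hcard]
  have hzn : ‖z‖ ^ 2 = n := by rw [hz, norm_sq_realVec_angular, hcard]
  have hT : (Matrix.toEuclideanLin H).IsPositive := hH ▸ isPositive_blockLaplacian hlam
  have hD1 : 1 ≤ D := by
    have h1 : (2 : ℝ) * k + 1 ≤ (2 * k + 1) ^ d :=
      le_self_pow₀ (by linarith [Nat.cast_nonneg (α := ℝ) k]) (by omega)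
    have h2 : (1 : ℝ) ≤ k := by exact_mod_cast hk
    linarith
  have hΛ₀ : 0 ≤ 2 * lam * D := by positivity
  have hΛ : ∀ x, inner ℝ x (Matrix.toEuclideanLin H x) ≤ 2 * lam * D * ‖x‖ ^ 2 := by
    intro x
    rw [← quadForm_eq_inner, hH, hD]
    exact quadForm_blockLaplacian_le hlam x
  have hbias : 1 / (2 * n) * inner ℝ h (Matrix.toEuclideanLin H h) ≤
      lam * Real.pi ^ 2 * M ^ 2 * (2 * (k : ℝ)) ^ (2 * α) * (d : ℝ) ^ (2 * α) * D
        / n ^ (2 * α / (d : ℝ)) := by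
    have h1 := quadForm_angular_le (k := k) hm hM hα₀ hlam hf
    rw [← hh, ← hH, ← hD, ← hn, quadForm_eq_inner] at h1
    have h2 := grid_spacing_rpow_le (k := k) hd hm hα₀
    rw [← hn] at h2
    calc 1 / (2 * n) * inner ℝ h (Matrix.toEuclideanLin H h)
        ≤ 1 / (2 * n) * _ := mul_le_mul_of_nonneg_left h1 (by positivity)
      _ = lam * Real.pi ^ 2 * M ^ 2 * D * ((k * Real.sqrt d / ((m : ℝ) - 1)) ^ α) ^ 2 := by
          field_simp
      _ ≤ lam * Real.pi ^ 2 * M ^ 2 * D * _ := mul_le_mul_of_nonneg_left h2 (by positivity)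
      _ = _ := by ring
  -- The two cases differ only in `ν`, the available upper bound for the multiplier.
  have hfinish : ∀ μ ν g, 0 < μ → μ ≤ ν → Matrix.toEuclideanLin H g + μ • g = z →
      ‖g‖ = ‖z‖ → IsTRSSolution H z n g ∧ (∀ g', IsTRSSolution H z n g' → g' = g) ∧
        1 / n * inner ℝ h g ≥
          1 - 3 * δ / 2
            - lam * Real.pi ^ 2 * M ^ 2 * (2 * (k : ℝ)) ^ (2 * α) * (d : ℝ) ^ (2 * α) * D
                / n ^ (2 * α / (d : ℝ))
            + 1 / (2 * lam * D + ν) ^ 2 * (1 / (2 * n) * quadForm H z) := by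
    intro μ ν g hμ hμν hg hgz
    have hgn : ‖g‖ ^ 2 = n := by rw [hgz, hzn]
    obtain ⟨h1, h2⟩ := isTRSSolution_unique_of_shift_eq hT hμ hg hgn
    refine ⟨h1, h2, ?_⟩
    have h3 := hT.le_inner_of_shift_eq hΛ₀ hΛ hμ hμν hδ₀ hδ₁ hn0 hg hgn hhn hzn hnoise
    rw [quadForm_eq_inner]
    linarith
  have hz0 : 0 < ‖z‖ := by
    refine (norm_nonneg z).lt_of_ne fun h0 => ?_
    rw [← h0] at hzn
    norm_num at hzn
    exact hn0.ne hzn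
  refine ⟨fun hzN => ?_, fun hzN hlamD => ?_, ?_⟩
  · have hv : ∃ v ∈ nullSpace H, inner ℝ v z ≠ 0 := by
      by_contra! hcon
      exact hzN fun v hv => hcon v hv
    obtain ⟨v, hvN, hvz⟩ := hv
    have hv0 : 0 < ‖v‖ := norm_pos_iff.2 fun h0 => hvz (by rw [h0, inner_zero_left])
    -- Pairing with the null vector `v` gives `⟨v, z⟩ = μ₀⟨v, g₀⟩`. This `μ₀` makes `|⟨v, g₀⟩| =
    -- ‖v‖‖z‖`, hence `‖g₀‖ ≥ ‖z‖`.
    set μ₀ : ℝ := |inner ℝ v z| / (‖v‖ * ‖z‖) with hμ₀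
    have hμ₀p : 0 < μ₀ := div_pos (abs_pos.2 hvz) (by positivity)
    have hμ₀1 : μ₀ ≤ 1 := (div_le_one (by positivity)).2 (abs_real_inner_le_norm v z)
    obtain ⟨g₀, hg₀⟩ := hT.exists_shift_eq hμ₀p z
    have hbig : ‖z‖ ≤ ‖g₀‖ := by
      have h2 := hT.isSymmetric v g₀
      rw [nullSpace, LinearMap.mem_ker] at hvN
      rw [hvN, inner_zero_left] at h2
      have h1 : inner ℝ v z = μ₀ * inner ℝ v g₀ := by
        rw [← hg₀, inner_add_right, inner_smul_right, ← h2, zero_add]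
      have h3 := abs_real_inner_le_norm v g₀
      have h4 : |inner ℝ v z| = μ₀ * (‖v‖ * ‖z‖) := by
        rw [hμ₀, div_mul_cancel₀ _ (by positivity)]
      rw [h1, abs_mul, abs_of_pos hμ₀p] at h4
      have h5 := mul_left_cancel₀ hμ₀p.ne' h4
      rw [h5] at h3
      exact le_of_mul_le_mul_left h3 hv0
    obtain ⟨μ, g, hμ, hμ1, hg, hgz⟩ := hT.exists_shift_norm_eq hμ₀p hμ₀1 hg₀ hbig
    exact ⟨g, hfinish μ 1 g (hμ₀p.trans_le hμ) hμ1 hg hgz⟩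
  · have hΛ1 : 2 * lam * D < 1 := by
      rw [lt_div_iff₀ (by positivity)] at hlamD
      linarith
    -- With this shift `H + μ₀` has norm at most `1`, so its inverse cannot shrink `z`; the bound on
    -- `λ` makes the shift positive.
    have hμ₀p : 0 < 1 - 2 * lam * D := by linarith
    obtain ⟨g₀, hg₀⟩ := hT.exists_shift_eq hμ₀p z
    have hbig : ‖z‖ ≤ ‖g₀‖ := by
      have := hT.norm_shift_le_add hΛ₀ hΛ hμ₀p.le g₀
      rw [hg₀] at this
      linarith
    obtain ⟨μ, g, hμ, -, hg, hgz⟩ := hT.exists_shift_norm_eq hμ₀p (by linarith) hg₀ hbig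
    have hμp := hμ₀p.trans_le hμ
    -- Pairing the equation with `g` gives `gᵀHg + μn = ⟨g, z⟩ ≤ n`, and Fiedler's bound controls
    -- `gᵀHg` from below.
    have hμν : μ ≤ 1 - 4 * lam * κ * Real.sin (Real.pi / (2 * n)) ^ 2 := by
      have hgN := mem_nullSpace_orthogonal_of_shift_eq hT hμp hg hzN
      rw [hH] at hgN
      have h1 := le_quadForm_blockLaplacian hlam hgN
      rw [← hH, ← hκ, ← hn, quadForm_eq_inner, hgz, hzn] at h1
      have h2 := real_inner_le_norm g z
      rw [← hg, inner_add_right, inner_smul_right, real_inner_self_eq_norm_sq, hg, hgz, hzn,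
        ← sq, hzn] at h2
      refine le_of_mul_le_mul_right ?_ hn0
      linarith
    have := hfinish μ _ g hμp hμν hg hgz
    refine ⟨g, this.1, this.2.1, ?_⟩
    rw [show 1 + 2 * lam * D - 4 * lam * κ * Real.sin (Real.pi / (2 * n)) ^ 2
      = 2 * lam * D + (1 - 4 * lam * κ * Real.sin (Real.pi / (2 * n)) ^ 2) by ring]
    exact this.2.2
  · rw [hκ, ← natCast_succ_pow_sub_one]
    exact_mod_cast vertexConnectivity_chebyshevGraph_le (by omega)
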